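/- **Theorem 3.1.** Let $H$ be a separable complex Hilbert space, let $A : D(A)\subset H\to H$ be a selfadjoint operator, and let $a,b\in\mathbb R$ with $a<b$. Let $H_+$ be $D(A)$ with the inner product $(f,g)_+=(Af,Ag)_H+(f,g)_H$, let $H_-\supset H$ be its dual with respect to $H$ (the bounded conjugate-linear functionals on $H_+$, where $x\in H$ is identified with $g\mapsto (x,g)_H$), and let $\tilde A:H\to H_-$, $(\tilde A x)(g)=(x,Ag)_H$ for $g \in H_+$, be the extension of $A$ that is the adjoint of $A:H_+\to H$. Let $L$ be the maximal operator generated by $\tilde l(u)=iu'+\tilde Au$ in $L^2=L^2(H,(-\infty,a))\oplus L^2(H,(b,+\infty))$: its domain $D(L)$ consists of those $u=(u_1,u_2)\in L^2$ such that $u_1$ and $u_2$ are, as $H_-$-valued functions, locally absolutely continuous (after modification on a null set) and differentiable almost everywhere, with $(iu_1'+\tilde Au_1,\;iu_2'+\tilde Au_2)\in L^2$, and $Lu=(iu_1'+\tilde Au_1,\;iu_2'+\tilde Au_2)$. For a unitary operator $W:H\to H$ let $L_W$ be the restriction of $L$ to the set of those $u\in D(L)$ that satisfy the boundary condition $$u_2(b)=W\,u_1(a),$$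 where the boundary values $u_1(a),u_2(b)\in H$ are the limits in $H_-$ of $u_1(t)$ as $t\to a^-$ and of $u_2(t)$ as $t\to b^+$. Then for every unitary operator $W$ in $H$ the point spectrum of $L_W$ is empty, $\sigma_p(L_W)=\emptyset$; that is, there are no $\lambda\in\mathbb C$ and $0\neq u\in D(L_W)$ with $L_Wu=\lambda u$. -/

import Mathlib

open Set Filter Topology MeasureTheory
open scoped ENNReal

noncomputable section

namespace SingularDiffOp

variable {H : Type*} [NormedAddCommGroup H] [InnerProductSpace ℂ H]

/-! ### The rigging `H₊ ⊂ H ⊂ H₋` of a linear operator `A` in `H` -/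

/-- `H₊`: the linear manifold `D(A)`, which carries the inner product
`(f, g)₊ = (A f, A g) + (f, g)` defined below. -/
def HPlus (A : H →ₗ.[ℂ] H) : Type _ := A.domain

namespace HPlus

variable (A : H →ₗ.[ℂ] H)

instance : AddCommGroup (HPlus A) := inferInstanceAs (AddCommGroup A.domain)

instance : Module ℂ (HPlus A) := inferInstanceAs (Module ℂ A.domain)

/-- The embedding `H₊ → H`. -/
def incl : HPlus A →ₗ[ℂ] H := A.domain.subtype

/-- The operator `A`, as a linear map `H₊ → H`. -/
def op : HPlus A →ₗ[ℂ] H := A.toFun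

/-- The inner product `(f, g)₊ = (A f, A g) + (f, g)`. -/
@[reducible]
def core : InnerProductSpace.Core ℂ (HPlus A) where
  inner f g := inner ℂ (op A f) (op A g) + inner ℂ (incl A f) (incl A g)
  conj_inner_symm f g := by simp [inner_conj_symm]
  re_inner_nonneg f := by
    rw [map_add]
    exact add_nonneg inner_self_nonneg inner_self_nonneg
  add_left f g h := by simp only [map_add, inner_add_left]; ring
  smul_left f g c := by simp only [map_smul, inner_smul_left]; ring
  definite f hf := by
    have h := congrArg Complex.re hf
    have h1 : 0 ≤ (inner ℂ (op A f) (op A f)).re := inner_self_nonneg (𝕜 := ℂ)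
    have h2 : 0 ≤ (inner ℂ (incl A f) (incl A f)).re := inner_self_nonneg (𝕜 := ℂ)
    simp only [Complex.add_re, Complex.zero_re] at h
    have h3 : (inner ℂ (incl A f) (incl A f)).re = 0 := by linarith
    have h4 : incl A f = 0 := inner_self_eq_zero.mp
      (by rw [← inner_self_ofReal_re (𝕜 := ℂ)]; simpa using h3)
    exact Subtype.ext h4

instance : NormedAddCommGroup (HPlus A) := (core A).toNormedAddCommGroup

instance : InnerProductSpace ℂ (HPlus A) := InnerProductSpace.ofCore (core A).toCore

theorem inner_def (f g : HPlus A) :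
    inner ℂ f g = inner ℂ (op A f) (op A g) + inner ℂ (incl A f) (incl A g) := rfl

theorem norm_sq_eq (f : HPlus A) : ‖f‖ ^ 2 = ‖op A f‖ ^ 2 + ‖incl A f‖ ^ 2 := by
  rw [InnerProductSpace.norm_sq_eq_re_inner (𝕜 := ℂ), inner_def, map_add,
    ← InnerProductSpace.norm_sq_eq_re_inner, ← InnerProductSpace.norm_sq_eq_re_inner]

theorem norm_op_le (f : HPlus A) : ‖op A f‖ ≤ ‖f‖ := by
  refine (sq_le_sq₀ (norm_nonneg _) (norm_nonneg _)).mp ?_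
  rw [norm_sq_eq]
  exact le_add_of_nonneg_right (sq_nonneg _)

theorem norm_incl_le (f : HPlus A) : ‖incl A f‖ ≤ ‖f‖ := by
  refine (sq_le_sq₀ (norm_nonneg _) (norm_nonneg _)).mp ?_
  rw [norm_sq_eq]
  exact le_add_of_nonneg_left (sq_nonneg _)

/-- The embedding `H₊ → H`, which is bounded. -/
def inclL : HPlus A →L[ℂ] H :=
  (incl A).mkContinuous 1 fun f => by simpa using norm_incl_le A f

/-- The operator `A`, which is bounded from `H₊` to `H`. -/
def opL : HPlus A →L[ℂ] H :=
  (op A).mkContinuous 1 fun f => by simpa using norm_op_le A f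

end HPlus

/-- `H₋`: the space of bounded conjugate-linear functionals on `H₊`, with the dual (negative)
norm. -/
def HMinus (A : H →ₗ.[ℂ] H) : Type _ := HPlus A →L⋆[ℂ] ℂ

namespace HMinus

variable (A : H →ₗ.[ℂ] H)

instance : NormedAddCommGroup (HMinus A) :=
  inferInstanceAs (NormedAddCommGroup (HPlus A →L⋆[ℂ] ℂ))

instance : NormedSpace ℂ (HMinus A) :=
  inferInstanceAs (NormedSpace ℂ (HPlus A →L⋆[ℂ] ℂ))

instance : CompleteSpace (HMinus A) :=
  inferInstanceAs (CompleteSpace (HPlus A →L⋆[ℂ] ℂ))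

/-- A bounded conjugate-linear functional on `H₊`, as an element of `H₋`. -/
def of : (HPlus A →L⋆[ℂ] ℂ) ≃ₗᵢ[ℂ] HMinus A := LinearIsometryEquiv.refl ℂ _

end HMinus

section Rigging

variable (A : H →ₗ.[ℂ] H)

/-- The embedding `H → H₋`: the vector `x` is identified with the functional `g ↦ (x, g)`.
(Mathlib's `inner ℂ g x` is linear in `x` and conjugate-linear in `g`.) -/
def embMinus : H →ₗ[ℂ] HMinus A where
  toFun x := HMinus.of A (((innerSL ℂ).flip x).comp (HPlus.inclL A))
  map_add' x y := by rw [← map_add]; congr 1; ext g; simp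
  map_smul' c x := by rw [RingHom.id_apply, ← map_smul]; congr 1; ext g; simp

@[simp]
theorem embMinus_apply (x : H) (g : HPlus A) :
    (HMinus.of A).symm (embMinus A x) g = inner ℂ (HPlus.incl A g) x := rfl

/-- The extension `Ã : H → H₋` of `A`: the adjoint of the bounded operator `A : H₊ → H`, that is,
`(Ã x)(g) = (x, A g)` for `g ∈ H₊`. -/
def tildeOp : H →ₗ[ℂ] HMinus A where
  toFun x := HMinus.of A (((innerSL ℂ).flip x).comp (HPlus.opL A))
  map_add' x y := by rw [← map_add]; congr 1; ext g; simp
  map_smul' c x := by rw [RingHom.id_apply, ← map_smul]; congr 1; ext g; simp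

@[simp]
theorem tildeOp_apply (x : H) (g : HPlus A) :
    (HMinus.of A).symm (tildeOp A x) g = inner ℂ (HPlus.op A g) x := rfl

variable {A}

/-- If `D(A)` is dense then `H → H₋` is injective. -/
theorem embMinus_injective (hA : Dense (A.domain : Set H)) :
    Function.Injective (embMinus A) := by
  refine (injective_iff_map_eq_zero _).mpr fun x hx => ?_
  refine hA.eq_zero_of_inner_right (𝕜 := ℂ) fun v hv => ?_
  have h := embMinus_apply A x (⟨v, hv⟩ : A.domain)
  rw [hx, LinearIsometryEquiv.map_zero] at h
  exact h.symm

end Rigging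

/-! ### The maximal operator on an open interval `J` -/

/-- `L²(H, J)`. -/
abbrev L2 (H : Type*) [NormedAddCommGroup H] (J : Set ℝ) : Type _ :=
  Lp H 2 (volume.restrict J)

variable (A : H →ₗ.[ℂ] H) (J : Set ℝ)

/-- `v` is the (locally) absolutely continuous representative of `u`, viewed as an `H₋`-valued
function on the interval `J`: it is absolutely continuous in the norm of `H₋` on each compact
subinterval of `J`, and it equals `u` almost everywhere on `J`. -/
structure IsACRep (u : ℝ → H) (v : ℝ → HMinus A) : Prop where
  ac : ∀ c d : ℝ, c ≤ d → Icc c d ⊆ J → AbsolutelyContinuousOnInterval v c d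
  ae_eq : ∀ᵐ t ∂volume.restrict J, v t = embMinus A (u t)

/-- `l̃(u) = i u' + Ã u = f` on `J`: the function `u` is (locally) absolutely continuous in `H₋`,
and for almost every `t ∈ J` it is differentiable at `t` in `H₋` and the equation
`i u'(t) + Ã u(t) = f(t)` holds in `H₋`. -/
def SolvesOn (u f : ℝ → H) : Prop :=
  ∃ v : ℝ → HMinus A, IsACRep A J u v ∧
    ∀ᵐ t ∂volume.restrict J, DifferentiableAt ℝ v t ∧
      Complex.I • deriv v t + tildeOp A (u t) = embMinus A (f t)

section Linear

variable {A J} {u u' f f' : ℝ → H} {v v' : ℝ → HMinus A}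

theorem IsACRep.congr (h : IsACRep A J u v) (hu : u' =ᵐ[volume.restrict J] u) :
    IsACRep A J u' v := by
  refine ⟨h.ac, ?_⟩
  filter_upwards [h.ae_eq, hu] with t h1 h2
  rw [h1, h2]

theorem IsACRep.zero : IsACRep A J (fun _ => 0) (fun _ => 0) := by
  refine ⟨fun c d _ _ => ?_, ?_⟩
  · exact (LipschitzWith.const (0 : HMinus A)).lipschitzOnWith.absolutelyContinuousOnInterval
  · exact Eventually.of_forall fun t => (map_zero (embMinus A)).symm

theorem IsACRep.add (h : IsACRep A J u v) (h' : IsACRep A J u' v') :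
    IsACRep A J (fun t => u t + u' t) (fun t => v t + v' t) := by
  refine ⟨fun c d hcd hs => (h.ac c d hcd hs).add (h'.ac c d hcd hs), ?_⟩
  filter_upwards [h.ae_eq, h'.ae_eq] with t h1 h2
  rw [h1, h2, map_add]

theorem IsACRep.smul (k : ℂ) (h : IsACRep A J u v) :
    IsACRep A J (fun t => k • u t) (fun t => k • v t) := by
  refine ⟨fun c d hcd hs => (h.ac c d hcd hs).const_smul k, ?_⟩
  filter_upwards [h.ae_eq] with t h1
  rw [h1, map_smul]

theorem IsACRep.continuousOn (h : IsACRep A J u v) (hJ : IsOpen J) : ContinuousOn v J := by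
  intro t ht
  obtain ⟨ε, hε, hb⟩ := Metric.isOpen_iff.mp hJ t ht
  have hsub : Icc (t - ε / 2) (t + ε / 2) ⊆ J := by
    intro s hs
    apply hb
    rw [Metric.mem_ball, Real.dist_eq, abs_lt]
    constructor <;> linarith [hs.1, hs.2]
  have hc := (h.ac (t - ε / 2) (t + ε / 2) (by linarith) hsub).continuousOn
  rw [uIcc_of_le (by linarith)] at hc
  exact (hc.continuousAt (Icc_mem_nhds (by linarith) (by linarith))).continuousWithinAt

/-- The absolutely continuous representative is unique on an open interval. -/
theorem IsACRep.eqOn (h : IsACRep A J u v) (hJ : IsOpen J) (h' : IsACRep A J u v') :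
    EqOn v v' J := by
  refine Measure.eqOn_open_of_ae_eq (μ := volume) ?_ hJ (h.continuousOn hJ) (h'.continuousOn hJ)
  filter_upwards [h.ae_eq, h'.ae_eq] with t h1 h2
  rw [h1, h2]

theorem SolvesOn.congr (h : SolvesOn A J u f) (hu : u' =ᵐ[volume.restrict J] u)
    (hf : f' =ᵐ[volume.restrict J] f) : SolvesOn A J u' f' := by
  obtain ⟨v, hv, he⟩ := h
  refine ⟨v, hv.congr hu, ?_⟩
  filter_upwards [he, hu, hf] with t h1 h2 h3
  rw [h2, h3]
  exact h1

theorem SolvesOn.zero : SolvesOn A J (fun _ => 0) (fun _ => 0) := by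
  refine ⟨fun _ => 0, IsACRep.zero, Eventually.of_forall fun t => ⟨?_, ?_⟩⟩
  · exact differentiableAt_const _
  · simp

theorem SolvesOn.add (h : SolvesOn A J u f) (h' : SolvesOn A J u' f') :
    SolvesOn A J (fun t => u t + u' t) (fun t => f t + f' t) := by
  obtain ⟨v, hv, he⟩ := h
  obtain ⟨v', hv', he'⟩ := h'
  refine ⟨_, hv.add hv', ?_⟩
  filter_upwards [he, he'] with t h1 h2
  refine ⟨h1.1.fun_add h2.1, ?_⟩
  rw [deriv_fun_add h1.1 h2.1, map_add, map_add, ← h1.2, ← h2.2, smul_add]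
  abel

theorem SolvesOn.smul (k : ℂ) (h : SolvesOn A J u f) :
    SolvesOn A J (fun t => k • u t) (fun t => k • f t) := by
  obtain ⟨v, hv, he⟩ := h
  refine ⟨_, hv.smul k, ?_⟩
  filter_upwards [he] with t h1
  refine ⟨h1.1.fun_const_smul k, ?_⟩
  rw [deriv_fun_const_smul k h1.1, map_smul, map_smul, ← h1.2, smul_add, smul_comm]

end Linear

/-- The graph of the maximal operator generated by `l̃` in `L²(H, J)`: the pairs `(u, f)` in
`L² × L²` with `i u' + Ã u = f`. -/
def maxGraph : Submodule ℂ (L2 H J × L2 H J) where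
  carrier := {p | SolvesOn A J p.1 p.2}
  zero_mem' := SolvesOn.zero.congr (Lp.coeFn_zero H 2 _) (Lp.coeFn_zero H 2 _)
  add_mem' := fun {p q} hp hq =>
    (SolvesOn.add hp hq).congr (Lp.coeFn_add p.1 q.1) (Lp.coeFn_add p.2 q.2)
  smul_mem' := fun k p hp =>
    (SolvesOn.smul k hp).congr (Lp.coeFn_smul k p.1) (Lp.coeFn_smul k p.2)

/-- The maximal operator generated by `l̃` in `L²(H, J)`. Its domain consists of the `u ∈ L²(H, J)`
that are absolutely continuous in `H₋` with `i u' + Ã u ∈ L²(H, J)`, and it sends `u` to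
`i u' + Ã u`. -/
def maxOp : L2 H J →ₗ.[ℂ] L2 H J := (maxGraph A J).toLinearPMap

variable {A J}

/-- On an open set, `i u' + Ã u` is determined by `u`, as soon as `D(A)` is dense. -/
theorem maxGraph_singleValued (hA : Dense (A.domain : Set H)) (hJ : IsOpen J)
    (p : L2 H J × L2 H J) (hp : p ∈ maxGraph A J) (h0 : p.1 = 0) : p.2 = 0 := by
  obtain ⟨u, f⟩ := p
  obtain ⟨v, ⟨hac, hae⟩, hv⟩ := hp
  simp only at h0
  subst h0
  have hz : ∀ᵐ t ∂volume.restrict J, ((0 : L2 H J) : ℝ → H) t = 0 :=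
    Lp.coeFn_zero H 2 (volume.restrict J)
  have hv0 : EqOn v (fun _ => 0) J :=
    (IsACRep.congr ⟨hac, hae⟩ (hz.mono fun t ht => ht.symm)).eqOn hJ IsACRep.zero
  refine (Lp.eq_zero_iff_ae_eq_zero (f := f)).mpr ?_
  filter_upwards [hv, hz, ae_restrict_mem hJ.measurableSet] with t h1 h2 h3
  have hd : deriv v t = 0 := by
    have : v =ᶠ[𝓝 t] fun _ => 0 := hv0.eventuallyEq_of_mem (hJ.mem_nhds h3)
    rw [this.deriv_eq, deriv_const]
  have h4 := h1.2
  simp only [h2, hd, map_zero, smul_zero, add_zero] at h4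
  exact embMinus_injective hA (by rw [← h4, Pi.zero_apply, map_zero])

/-- The graph of the maximal operator is the set of pairs with `i u' + Ã u = f`. -/
theorem mem_graph_maxOp_iff (hA : Dense (A.domain : Set H)) (hJ : IsOpen J) (u f : L2 H J) :
    (u, f) ∈ (maxOp A J).graph ↔ SolvesOn A J u f := by
  rw [maxOp, Submodule.toLinearPMap_graph_eq _ (maxGraph_singleValued hA hJ)]
  rfl

/-! ### The multipoint operators in `L²(H, (-∞, a)) ⊕ L²(H, (b, ∞))` -/

/-- The Hilbert space `L² = L²(H, (-∞, a)) ⊕ L²(H, (b, ∞))`. -/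
abbrev L2Sum (H : Type*) [NormedAddCommGroup H] (a b : ℝ) : Type _ :=
  WithLp 2 (L2 H (Iio a) × L2 H (Ioi b))

/-- The direct sum of two partially defined operators, in the Hilbert direct sum. -/
def directSum {E F : Type*} [NormedAddCommGroup E] [InnerProductSpace ℂ E]
    [NormedAddCommGroup F] [InnerProductSpace ℂ F] (S : E →ₗ.[ℂ] E) (T : F →ₗ.[ℂ] F) :
    WithLp 2 (E × F) →ₗ.[ℂ] WithLp 2 (E × F) where
  domain :=
    { carrier := {u | u.fst ∈ S.domain ∧ u.snd ∈ T.domain}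
      zero_mem' := ⟨S.domain.zero_mem, T.domain.zero_mem⟩
      add_mem' := fun hu hv => ⟨S.domain.add_mem hu.1 hv.1, T.domain.add_mem hu.2 hv.2⟩
      smul_mem' := fun c _ hu => ⟨S.domain.smul_mem c hu.1, T.domain.smul_mem c hu.2⟩ }
  toFun :=
    { toFun := fun u => WithLp.toLp 2 (S ⟨u.1.fst, u.2.1⟩, T ⟨u.1.snd, u.2.2⟩)
      map_add' := fun u v => by
        have h1 := S.map_add ⟨u.1.fst, u.2.1⟩ ⟨v.1.fst, v.2.1⟩
        have h2 := T.map_add ⟨u.1.snd, u.2.2⟩ ⟨v.1.snd, v.2.2⟩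
        exact congrArg (WithLp.toLp 2) (Prod.ext h1 h2)
      map_smul' := fun c u => by
        have h1 := S.map_smul c ⟨u.1.fst, u.2.1⟩
        have h2 := T.map_smul c ⟨u.1.snd, u.2.2⟩
        exact congrArg (WithLp.toLp 2) (Prod.ext h1 h2) }

/-- The maximal operator `L = L₁ ⊕ L₂`, where `L₁` and `L₂` are the maximal operators generated by
`l̃` in `L²(H, (-∞, a))` and `L²(H, (b, ∞))`. -/
def maxSum (A : H →ₗ.[ℂ] H) (a b : ℝ) : L2Sum H a b →ₗ.[ℂ] L2Sum H a b :=
  directSum (maxOp A (Iio a)) (maxOp A (Ioi b))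

/-- The boundary value of `u` at the end point `c` of the open half-line `J` is `h ∈ H`: the
absolutely continuous representative of `u` tends to `h` in `H₋` at `c` from within `J`. For a
densely defined `A` there is at most one such `h`. -/
def HasBoundaryValue (A : H →ₗ.[ℂ] H) (J : Set ℝ) (c : ℝ) (u : ℝ → H) (h : H) : Prop :=
  ∃ v : ℝ → HMinus A, IsACRep A J u v ∧ Tendsto v (𝓝[J] c) (𝓝 (embMinus A h))

section LinearBoundary

variable {A : H →ₗ.[ℂ] H} {J : Set ℝ} {c : ℝ} {u u' : ℝ → H} {h h' : H}

theorem HasBoundaryValue.congr (hu : HasBoundaryValue A J c u h)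
    (he : u' =ᵐ[volume.restrict J] u) : HasBoundaryValue A J c u' h := by
  obtain ⟨v, hv, ht⟩ := hu
  exact ⟨v, hv.congr he, ht⟩

theorem HasBoundaryValue.zero : HasBoundaryValue A J c (fun _ => 0) 0 :=
  ⟨_, IsACRep.zero, by rw [map_zero]; exact tendsto_const_nhds⟩

theorem HasBoundaryValue.add (hu : HasBoundaryValue A J c u h)
    (hu' : HasBoundaryValue A J c u' h') :
    HasBoundaryValue A J c (fun t => u t + u' t) (h + h') := by
  obtain ⟨v, hv, ht⟩ := hu
  obtain ⟨v', hv', ht'⟩ := hu'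
  exact ⟨_, hv.add hv', by rw [map_add]; exact ht.add ht'⟩

theorem HasBoundaryValue.smul (k : ℂ) (hu : HasBoundaryValue A J c u h) :
    HasBoundaryValue A J c (fun t => k • u t) (k • h) := by
  obtain ⟨v, hv, ht⟩ := hu
  exact ⟨_, hv.smul k, by rw [map_smul]; exact ht.const_smul k⟩

/-- The boundary value is unique. -/
theorem HasBoundaryValue.unique (hA : Dense (A.domain : Set H)) (hJ : IsOpen J) (hc : c ∈ closure J)
    (hu : HasBoundaryValue A J c u h) (hu' : HasBoundaryValue A J c u h') : h = h' := by
  obtain ⟨v, hv, ht⟩ := hu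
  obtain ⟨v', hv', ht'⟩ := hu'
  have : (𝓝[J] c).NeBot := mem_closure_iff_nhdsWithin_neBot.mp hc
  have he : v =ᶠ[𝓝[J] c] v' := (hv.eqOn hJ hv').eventuallyEq_of_mem self_mem_nhdsWithin
  exact embMinus_injective hA (tendsto_nhds_unique ht (ht'.congr' he.symm))

end LinearBoundary

/-- The boundary condition `u₂(b) = W u₁(a)`. -/
def boundaryCondition (A : H →ₗ.[ℂ] H) (a b : ℝ) (W : H ≃ₗᵢ[ℂ] H) :
    Submodule ℂ (L2Sum H a b) where
  carrier := {u | ∃ h : H, HasBoundaryValue A (Iio a) a u.fst h ∧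
    HasBoundaryValue A (Ioi b) b u.snd (W h)}
  zero_mem' := ⟨0, HasBoundaryValue.zero.congr (Lp.coeFn_zero H 2 _),
    (map_zero W).symm ▸ HasBoundaryValue.zero.congr (Lp.coeFn_zero H 2 _)⟩
  add_mem' := by
    rintro u u' ⟨h, h1, h2⟩ ⟨h', h1', h2'⟩
    exact ⟨h + h', (h1.add h1').congr (Lp.coeFn_add u.fst u'.fst),
      (map_add W h h').symm ▸ (h2.add h2').congr (Lp.coeFn_add u.snd u'.snd)⟩
  smul_mem' := by
    rintro k u ⟨h, h1, h2⟩
    exact ⟨k • h, (h1.smul k).congr (Lp.coeFn_smul k u.fst),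
      (map_smul W k h).symm ▸ (h2.smul k).congr (Lp.coeFn_smul k u.snd)⟩

/-- The extension `L_W` generated by `l̃` and the boundary condition `u₂(b) = W u₁(a)`: the
restriction of the maximal operator `L` to the `u ∈ D(L)` with `u₂(b) = W u₁(a)`. -/
def extensionOp (A : H →ₗ.[ℂ] H) (a b : ℝ) (W : H ≃ₗᵢ[ℂ] H) :
    L2Sum H a b →ₗ.[ℂ] L2Sum H a b :=
  (maxSum A a b).domRestrict (boundaryCondition A a b W)

/-- The point spectrum: the set of eigenvalues of a partially defined operator. -/
def pointSpectrum {E : Type*} [NormedAddCommGroup E] [InnerProductSpace ℂ E]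
    (T : E →ₗ.[ℂ] E) : Set ℂ :=
  {z | ∃ u : T.domain, (u : E) ≠ 0 ∧ T u = z • (u : E)}

end SingularDiffOp

end

/-! ### Growth of absolutely continuous functions, and constants below `L^p` functions -/

namespace SingularDiffOp

/-! An eigenfunction only solves `i u' + Ã u = z u` in `H₋`, so it is first regularized: `w = S v`,
with `S` the extension of `(A - i)⁻¹` to `H₋` and `v` the continuous representative. Then `w` lies
in `D(A)` almost everywhere and `i w' + A w = z w` holds in `H`. Since `(w, A w)` is real, `Re (w,
w') = Im z ‖w‖²`, so `‖w‖² exp (-2 Im z t)` is constant on each half-line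
(`exists_norm_sq_eq_of_solvesOn`).

If `Im z ≤ 0`, then `‖w‖` is bounded below on `(-∞, a)` by a multiple of that constant's square
root, and `‖w‖ ≤ ‖u‖` with `u` in `L²` forces the constant to be zero
(`eqOn_zero_of_solvesOn_of_memLp`). Hence `u₁ = 0`, its boundary value is `0`, and `W` carries this
to `u₂(b) = 0`; the conserved quantity on `(b, ∞)` then vanishes by its limit at `b`
(`eqOn_zero_of_solvesOn_of_tendsto`). For `Im z ≥ 0` the half-lines exchange roles, through
injectivity of `W`. -/

theorem _root_.LipschitzWith.comp_absolutelyContinuousOnInterval {X Y : Type*}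
    [PseudoMetricSpace X] [PseudoMetricSpace Y] {φ : X → Y} {K : NNReal} (hφ : LipschitzWith K φ)
    {f : ℝ → X} {c d : ℝ} (hf : AbsolutelyContinuousOnInterval f c d) :
    AbsolutelyContinuousOnInterval (fun t => φ (f t)) c d := by
  refine squeeze_zero (fun E => Finset.sum_nonneg fun i _ => dist_nonneg) (fun E => ?_)
    (by simpa using Tendsto.const_mul (K : ℝ) hf)
  rw [Finset.mul_sum]
  exact Finset.sum_le_sum fun i _ => hφ.dist_le_mul _ _

variable {H : Type*} [NormedAddCommGroup H] [InnerProductSpace ℂ H]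

/-- If `(w, w')` has real part `k ‖w‖²` almost everywhere, then `‖w t‖² exp (-2 k t)` is
constant. -/
theorem exists_norm_sq_mul_exp_eq {w : ℝ → H} {k c d : ℝ}
    (hw : AbsolutelyContinuousOnInterval w c d)
    (hd : ∀ᵐ t, t ∈ uIcc c d →
      ∃ w', HasDerivAt w w' t ∧ (inner ℂ (w t) w').re = k * ‖w t‖ ^ 2) :
    ∃ C, ∀ t ∈ uIcc c d, ‖w t‖ ^ 2 * Real.exp (-(2 * k) * t) = C := by
  have hn : AbsolutelyContinuousOnInterval (fun t => ‖w t‖) c d :=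
    lipschitzWith_one_norm.comp_absolutelyContinuousOnInterval hw
  have he : AbsolutelyContinuousOnInterval (fun t => Real.exp (-(2 * k) * t)) c d := by
    refine ContDiffOn.absolutelyContinuousOnInterval (ContDiff.contDiffOn ?_)
    fun_prop
  have hF := (hn.fun_mul hn).fun_mul he
  obtain ⟨C, hC⟩ := hF.const_of_ae_hasDerivAt_zero (by
    filter_upwards [hd] with t ht hmem
    obtain ⟨w', hw', hre⟩ := ht hmem
    have h1 := (Complex.reCLM.hasFDerivAt.comp_hasDerivAt t (hw'.inner ℂ hw'))
    have h2 : HasDerivAt (fun t => ‖w t‖ * ‖w t‖) (2 * (k * ‖w t‖ ^ 2)) t := by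
      convert! h1 using 1
      · ext s
        simp only [Function.comp_apply, Complex.reCLM_apply]
        rw [← sq, InnerProductSpace.norm_sq_eq_re_inner (𝕜 := ℂ)]
        rfl
      · rw [Complex.reCLM_apply, Complex.add_re, ← inner_conj_symm w' (w t), Complex.conj_re, hre]
        ring
    have h3 : HasDerivAt (fun t => Real.exp (-(2 * k) * t))
        (Real.exp (-(2 * k) * t) * (-(2 * k) * 1)) t :=
      ((hasDerivAt_id t).const_mul _).exp
    convert! h2.mul h3 using 1
    ring)
  exact ⟨C, fun t ht => by rw [sq]; exact hC t ht⟩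

/-- The constant `m` is dominated by an `L^p` function, and on a space of infinite measure only the
zero constant is in `L^p`. -/
theorem _root_.MeasureTheory.MemLp.eq_zero_of_le_norm {X E : Type*} [MeasurableSpace X]
    [NormedAddCommGroup E] {μ : Measure X} {p : ℝ≥0∞} {f : X → E} {m : ℝ} (hp0 : p ≠ 0)
    (hp : p ≠ ∞) (hf : MemLp f p μ) (hμ : μ univ = ∞) (hm : 0 ≤ m) (h : ∀ᵐ x ∂μ, m ≤ ‖f x‖) :
    m = 0 := by
  have h1 : MemLp (fun _ : X => m) p μ := by
    refine hf.of_le aestronglyMeasurable_const ?_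
    filter_upwards [h] with x hx
    rwa [Real.norm_of_nonneg hm]
  rw [memLp_const_iff hp0 hp, hμ] at h1
  simpa using h1

/-! ### The resolvents `(A ± i)⁻¹` and their extension to `H₋` -/

section Resolvent

variable {A : H →ₗ.[ℂ] H}

theorem inner_op_eq [CompleteSpace H] (hA : IsSelfAdjoint A) (f g : HPlus A) :
    inner ℂ (HPlus.op A f) (HPlus.incl A g) = inner ℂ (HPlus.incl A f) (HPlus.op A g) := by
  have h := LinearPMap.adjoint_isFormalAdjoint hA.dense_domain
  rw [LinearPMap.isSelfAdjoint_def.mp hA] at h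
  exact h f g

/-- The hypothesis places `(y, z)` in the graph of `A*`, which is the graph of `A`. -/
theorem exists_mem_of_inner_eq [CompleteSpace H] (hA : IsSelfAdjoint A) {y z : H}
    (h : ∀ f : HPlus A, inner ℂ z (HPlus.incl A f) = inner ℂ y (HPlus.op A f)) :
    ∃ g : HPlus A, HPlus.incl A g = y ∧ HPlus.op A g = z := by
  have hg : (y, z) ∈ A.graph := by
    have hm := LinearPMap.mem_adjoint_domain_of_exists (T := A) y ⟨z, h⟩
    have he := LinearPMap.adjoint_apply_eq hA.dense_domain ⟨y, hm⟩ (x₀ := z) h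
    have hmem : (y, z) ∈ A.adjoint.graph := by
      have := LinearPMap.mem_graph _ (⟨y, hm⟩ : A.adjoint.domain)
      rwa [he] at this
    rwa [LinearPMap.isSelfAdjoint_def.mp hA] at hmem
  obtain ⟨g, h1, h2⟩ := (LinearPMap.mem_graph_iff A).mp hg
  exact ⟨g, h1, h2⟩

/-- The norm of `H₊` is equivalent to the norm of the graph of `A` in `H × H`, and that graph is
closed. -/
theorem completeSpace_HPlus [CompleteSpace H] (hA : IsSelfAdjoint A) :
    CompleteSpace (HPlus A) := by
  let j : HPlus A →L[ℂ] H × H := (HPlus.inclL A).prod (HPlus.opL A)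
  -- `H × H` carries the sup norm, so `√2` would suffice; `2` is a convenient larger constant.
  have hj : AntilipschitzWith 2 j := by
    refine j.antilipschitz_of_bound fun f => ?_
    have h1 : ‖HPlus.incl A f‖ ≤ ‖j f‖ := norm_fst_le (j f)
    have h2 : ‖HPlus.op A f‖ ≤ ‖j f‖ := norm_snd_le (j f)
    have h3 := HPlus.norm_sq_eq A f
    refine abs_le_of_sq_le_sq' ?_ (by positivity) |>.2
    have := norm_nonneg (HPlus.incl A f)
    have := norm_nonneg (HPlus.op A f)
    push_cast
    nlinarith
  refine (completeSpace_iff_isComplete_range (hj.isUniformInducing j.uniformContinuous)).mpr ?_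
  have hr : range j = (A.graph : Set (H × H)) := by
    ext ⟨x, y⟩
    constructor
    · rintro ⟨f, hf⟩
      rw [← hf]
      exact A.mem_graph f
    · intro h
      obtain ⟨g, h1, h2⟩ := (LinearPMap.mem_graph_iff A).mp h
      exact ⟨g, Prod.ext h1 h2⟩
  rw [hr]
  exact IsClosed.isComplete hA.isClosed

/-- The cross term vanishes because `(A f, f)` is real and `s` is imaginary. -/
theorem norm_op_add_smul [CompleteSpace H] (hA : IsSelfAdjoint A) {s : ℂ}
    (hs : s = Complex.I ∨ s = -Complex.I) (f : HPlus A) :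
    ‖HPlus.op A f + s • HPlus.incl A f‖ = ‖f‖ := by
  refine (sq_eq_sq₀ (norm_nonneg _) (norm_nonneg _)).mp ?_
  have h0 : (inner ℂ (HPlus.op A f) (HPlus.incl A f)).im = 0 := by
    rw [← Complex.conj_eq_iff_im, inner_conj_symm, inner_op_eq hA]
  have hn : ‖s‖ = 1 := by rcases hs with rfl | rfl <;> simp
  rw [@norm_add_sq ℂ, HPlus.norm_sq_eq, norm_smul, hn, one_mul, inner_smul_right]
  have : RCLike.re (s * inner ℂ (HPlus.op A f) (HPlus.incl A f)) = 0 := by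
    rcases hs with rfl | rfl <;> simp [h0]
  rw [this]
  ring

/-- The operator `A + s`, as an isometry of `H₊` onto `H`, for `s = ± i`. -/
theorem exists_isometryEquiv_shift [CompleteSpace H] (hA : IsSelfAdjoint A) {s : ℂ}
    (hs : s = Complex.I ∨ s = -Complex.I) :
    ∃ T : HPlus A ≃ₗᵢ[ℂ] H, ∀ f, T f = HPlus.op A f + s • HPlus.incl A f := by
  have := completeSpace_HPlus hA
  let T : HPlus A →ₗᵢ[ℂ] H :=
    { toLinearMap := HPlus.op A + s • HPlus.incl A
      norm_map' := norm_op_add_smul hA hs }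
  have hT : ∀ f, T f = HPlus.op A f + s • HPlus.incl A f := fun f => rfl
  have hcl : IsClosed (LinearMap.range T.toLinearMap : Set H) := by
    have h := T.isometry.isUniformInducing.isComplete_range.isClosed
    rwa [LinearMap.coe_range]
  have hso : star s = -s := by rcases hs with rfl | rfl <;> simp
  have hbot : (LinearMap.range T.toLinearMap)ᗮ = ⊥ := by
    rw [Submodule.eq_bot_iff]
    intro y hy
    have hy' : ∀ f, inner ℂ (T f) y = 0 := fun f => hy _ ⟨f, rfl⟩
    -- Orthogonality of `y` to the range of `A + s` gives `A* y = s y`, as `s̄ = -s`. So `(A - s) y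
    -- = 0`, and `A - s` is isometric on `H₊`.
    obtain ⟨g, h1, h2⟩ := exists_mem_of_inner_eq hA (y := y) (z := s • y) fun f => by
      have h := hy' f
      rw [hT, inner_add_left, inner_smul_left] at h
      have h3 := congrArg star h
      simp only [star_add, star_mul', star_zero] at h3
      rw [← starRingEnd_apply, ← starRingEnd_apply, ← starRingEnd_apply, inner_conj_symm,
        inner_conj_symm, Complex.conj_conj] at h3
      rw [inner_smul_left, starRingEnd_apply, hso]
      linear_combination -h3
    have h4 : ‖g‖ = 0 := by
      have h5 : HPlus.op A g + (-s) • HPlus.incl A g = 0 := by rw [h1, h2]; simp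
      rw [← norm_op_add_smul hA (s := -s) (by rcases hs with rfl | rfl <;> simp) g, h5, norm_zero]
    rw [← h1, norm_eq_zero.mp h4, map_zero]
  have hsurj : Function.Surjective T := by
    have : LinearMap.range T.toLinearMap = ⊤ := by
      have : CompleteSpace (LinearMap.range T.toLinearMap) := hcl.completeSpace_coe
      exact (Submodule.orthogonal_eq_bot_iff).mp hbot
    exact LinearMap.range_eq_top.mp this
  exact ⟨LinearIsometryEquiv.ofSurjective T hsurj, hT⟩

/-- The resolvent `(A - i)⁻¹` extends to an injective bounded operator `S : H₋ → H`. Here `R` is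
`(A - i)⁻¹` as an operator `H → H₊`. -/
theorem exists_resolvent_HMinus [CompleteSpace H] (hA : IsSelfAdjoint A) :
    ∃ (S : HMinus A →L[ℂ] H) (R : H ≃ₗᵢ[ℂ] HPlus A), Function.Injective S ∧
      (∀ x, HPlus.op A (R x) - Complex.I • HPlus.incl A (R x) = x) ∧
      (∀ x, S (embMinus A x) = HPlus.incl A (R x)) ∧
      ∀ x, S (tildeOp A x) = x + Complex.I • HPlus.incl A (R x) := by
  obtain ⟨T, hT⟩ := exists_isometryEquiv_shift hA (Or.inl rfl)
  obtain ⟨T', hT'⟩ := exists_isometryEquiv_shift hA (Or.inr rfl)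
  -- `S` is to be the adjoint of `(A + i)⁻¹ : H → H₊`. The conjugation makes the functional linear,
  -- so that its Riesz vector can serve as `S v`.
  let ℓ (v : HMinus A) : H →L[ℂ] ℂ :=
    LinearMap.mkContinuous
      { toFun := fun x => starRingEnd ℂ ((HMinus.of A).symm v (T.symm x))
        map_add' := fun x y => by simp
        map_smul' := fun c x => by simp } ‖v‖ fun x => by
          have h := ((HMinus.of A).symm v).le_opNorm (T.symm x)
          rw [LinearIsometryEquiv.norm_map, LinearIsometryEquiv.norm_map] at h
          simpa using h
  have hℓ : ∀ v, ‖ℓ v‖ ≤ ‖v‖ := fun v => LinearMap.mkContinuous_norm_le _ (norm_nonneg _) _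
  let S : HMinus A →L[ℂ] H := LinearMap.mkContinuous
    { toFun := fun v => (InnerProductSpace.toDual ℂ H).symm (ℓ v)
      map_add' := fun v w => by
        rw [← map_add]
        congr 1
        ext x
        simp [ℓ]
      map_smul' := fun c v => by
        refine ext_inner_right ℂ fun x => ?_
        simp [ℓ, inner_smul_left] } 1 fun v => by
          simpa using hℓ v
  have hS : ∀ v x, inner ℂ (S v) x = starRingEnd ℂ ((HMinus.of A).symm v (T.symm x)) :=
    fun v x => InnerProductSpace.toDual_symm_apply
  have hR : ∀ x, HPlus.op A (T'.symm x) - Complex.I • HPlus.incl A (T'.symm x) = x := fun x => by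
    have h := hT' (T'.symm x)
    rw [T'.apply_symm_apply, neg_smul, ← sub_eq_add_neg] at h
    exact h.symm
  have hemb : ∀ x, S (embMinus A x) = HPlus.incl A (T'.symm x) := fun x => by
    refine ext_inner_right ℂ fun y => ?_
    -- Every test vector has the form `(A + i) f`, which undoes the inverse in the definition of
    -- `S`.
    obtain ⟨f, rfl⟩ := T.surjective y
    rw [hS, T.symm_apply_apply, embMinus_apply, inner_conj_symm, hT, inner_add_right,
      ← inner_op_eq hA, inner_smul_right]
    nth_rewrite 1 [← hR x]
    rw [inner_sub_left, inner_smul_left, Complex.conj_I]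
    ring
  refine ⟨S, T'.symm, (injective_iff_map_eq_zero S).mpr fun v hv => ?_, hR, hemb, fun x => ?_⟩
  · refine (HMinus.of A).symm.injective (ContinuousLinearMap.ext fun f => ?_)
    have h := hS v (T f)
    rw [hv, inner_zero_left, T.symm_apply_apply] at h
    rw [LinearIsometryEquiv.map_zero]
    exact (map_eq_zero _).mp h.symm
  · rw [← hemb]
    refine ext_inner_right ℂ fun y => ?_
    obtain ⟨f, rfl⟩ := T.surjective y
    rw [inner_add_left, inner_smul_left, hS, hS, T.symm_apply_apply, embMinus_apply,
      tildeOp_apply, inner_conj_symm, inner_conj_symm, hT, inner_add_right, inner_smul_right,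
      Complex.conj_I]
    ring

end Resolvent

/-! ### Solutions of `i u' + Ã u = z u` on an interval -/

section HalfLine

variable {A : H →ₗ.[ℂ] H} {J : Set ℝ} {u : ℝ → H} {v : ℝ → HMinus A} {z : ℂ}

/-- A solution of `i u' + Ã u = z u` whose regularization `S v` grows like `exp (Im z t)`. -/
theorem exists_norm_sq_eq_of_solvesOn [CompleteSpace H] {S : HMinus A →L[ℂ] H}
    {R : H ≃ₗᵢ[ℂ] HPlus A} (hA : IsSelfAdjoint A)
    (hR : ∀ x, HPlus.op A (R x) - Complex.I • HPlus.incl A (R x) = x)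
    (hemb : ∀ x, S (embMinus A x) = HPlus.incl A (R x))
    (htil : ∀ x, S (tildeOp A x) = x + Complex.I • HPlus.incl A (R x))
    (hJ : IsOpen J) (hJc : J.OrdConnected) (hv : IsACRep A J u v)
    (hsol : SolvesOn A J u fun t => z • u t) :
    ∃ C, ∀ t ∈ J, ‖S (v t)‖ ^ 2 * Real.exp (-(2 * z.im) * t) = C := by
  have hae : ∀ᵐ t, t ∈ J → ∃ w', HasDerivAt (fun t => S (v t)) w' t ∧
      (inner ℂ (S (v t)) w').re = z.im * ‖S (v t)‖ ^ 2 := by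
    obtain ⟨v₀, hv₀, hd⟩ := hsol
    rw [← ae_restrict_iff' hJ.measurableSet]
    filter_upwards [hv.ae_eq, hd, ae_restrict_mem hJ.measurableSet] with t h1 ⟨h2, h3⟩ ht
    have heq : v =ᶠ[𝓝 t] v₀ := (hv.eqOn hJ hv₀).eventuallyEq_of_mem (hJ.mem_nhds ht)
    have hder : HasDerivAt v (deriv v₀ t) t := h2.hasDerivAt.congr_of_eventuallyEq heq
    refine ⟨S (deriv v₀ t), (S.restrictScalars ℝ).hasFDerivAt.comp_hasDerivAt t hder, ?_⟩
    have h4 := congrArg S h3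
    rw [map_add, map_smul, htil, map_smul, map_smul, hemb] at h4
    rw [h1, hemb]
    set g := R (u t)
    -- Substituting `u = A g - i g` cancels the term `i g` from `S Ã u`, leaving `i S v' + A g = z
    -- g`.
    have h5 : S (deriv v₀ t) =
        Complex.I • HPlus.op A g - (Complex.I * z) • HPlus.incl A g := by
      rw [← hR (u t)] at h4
      rw [sub_add_cancel] at h4
      rw [mul_smul, ← h4, smul_add, smul_smul, Complex.I_mul_I, neg_one_smul]
      abel
    -- By symmetry `i (g, A g)` is imaginary, so only `Re (-i z) = Im z` survives.
    have h0 : (inner ℂ (HPlus.incl A g) (HPlus.op A g)).im = 0 := by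
      rw [← Complex.conj_eq_iff_im, inner_conj_symm, inner_op_eq hA]
    rw [h5, inner_sub_right, inner_smul_right, inner_smul_right, inner_self_eq_norm_sq_to_K]
    simp [h0, ← Complex.ofReal_pow]
  have hcon : ∀ c ∈ J, ∀ d ∈ J, ‖S (v c)‖ ^ 2 * Real.exp (-(2 * z.im) * c) =
      ‖S (v d)‖ ^ 2 * Real.exp (-(2 * z.im) * d) := by
    intro c hc d hd
    wlog hcd : c ≤ d generalizing c d
    · exact (this d hd c hc (le_of_not_ge hcd)).symm
    have hsub := hJc.out hc hd
    obtain ⟨C, hC⟩ := exists_norm_sq_mul_exp_eq (w := fun t => S (v t)) (k := z.im)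
      (S.lipschitz.comp_absolutelyContinuousOnInterval (hv.ac c d hcd hsub)) (by
        filter_upwards [hae] with t ht hmem
        rw [uIcc_of_le hcd] at hmem
        exact ht (hsub hmem))
    rw [hC c left_mem_uIcc, hC d right_mem_uIcc]
  rcases J.eq_empty_or_nonempty with rfl | ⟨c, hc⟩
  · exact ⟨0, by simp⟩
  · exact ⟨_, fun t ht => hcon t ht c hc⟩

/-- Uniqueness for the Cauchy problem: the conserved quantity equals its limit at `c`, which is
zero, and `S` is injective. -/
theorem eqOn_zero_of_solvesOn_of_tendsto [CompleteSpace H] (hA : IsSelfAdjoint A) (hJ : IsOpen J)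
    (hJc : J.OrdConnected) {c : ℝ} (hc : c ∈ closure J) (hv : IsACRep A J u v)
    (hsol : SolvesOn A J u fun t => z • u t) (hlim : Tendsto v (𝓝[J] c) (𝓝 0)) :
    EqOn v 0 J := by
  obtain ⟨S, R, hS, hR, hemb, htil⟩ := exists_resolvent_HMinus hA
  obtain ⟨C, hC⟩ := exists_norm_sq_eq_of_solvesOn hA hR hemb htil hJ hJc hv hsol
  have : (𝓝[J] c).NeBot := mem_closure_iff_nhdsWithin_neBot.mp hc
  have hC0 : C = 0 := by
    have h1 : Tendsto (fun t => ‖S (v t)‖ ^ 2 * Real.exp (-(2 * z.im) * t)) (𝓝[J] c)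
        (𝓝 (‖S 0‖ ^ 2 * Real.exp (-(2 * z.im) * c))) := by
      refine ((((S.continuous.tendsto 0).comp hlim).norm).pow 2).mul ?_
      have : Continuous fun t : ℝ => Real.exp (-(2 * z.im) * t) := by fun_prop
      exact (this.tendsto c).mono_left nhdsWithin_le_nhds
    rw [map_zero, norm_zero, zero_pow two_ne_zero, zero_mul] at h1
    refine tendsto_nhds_unique (tendsto_const_nhds.congr' ?_) h1
    filter_upwards [self_mem_nhdsWithin] with t ht using (hC t ht).symm
  intro t ht
  have h := hC t ht
  rw [hC0] at h
  have h2 : ‖S (v t)‖ ^ 2 = 0 := (mul_eq_zero.mp h).resolve_right (Real.exp_ne_zero _)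
  exact hS (by rw [Pi.zero_apply, map_zero]; simpa using h2)

/-- The condition `hz` bounds `exp (2 Im z t)` below on `J` by its value at `c`, so a nonzero
solution would stay away from zero on a set of infinite measure. -/
theorem eqOn_zero_of_solvesOn_of_memLp [CompleteSpace H] (hA : IsSelfAdjoint A) (hJ : IsOpen J)
    (hJc : J.OrdConnected) (hvol : volume J = ∞) {c : ℝ} (hz : ∀ t ∈ J, z.im * c ≤ z.im * t)
    (hu : MemLp u 2 (volume.restrict J)) (hv : IsACRep A J u v)
    (hsol : SolvesOn A J u fun t => z • u t) :
    EqOn v 0 J := by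
  obtain ⟨S, R, hS, hR, hemb, htil⟩ := exists_resolvent_HMinus hA
  obtain ⟨C, hC⟩ := exists_norm_sq_eq_of_solvesOn hA hR hemb htil hJ hJc hv hsol
  have hsq : ∀ t ∈ J, ‖S (v t)‖ ^ 2 = C * Real.exp (2 * z.im * t) := fun t ht => by
    rw [← hC t ht, mul_assoc, ← Real.exp_add, neg_mul, neg_add_cancel, Real.exp_zero, mul_one]
  have hC0 : ∀ t ∈ J, 0 ≤ C := fun t ht => by
    rw [← hC t ht]
    positivity
  have hm : √(C * Real.exp (2 * z.im * c)) = 0 := by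
    refine hu.eq_zero_of_le_norm two_ne_zero ENNReal.ofNat_ne_top (by simpa using hvol)
      (Real.sqrt_nonneg _) ?_
    filter_upwards [hv.ae_eq, ae_restrict_mem hJ.measurableSet] with t h1 ht
    refine Real.sqrt_le_iff.mpr ⟨norm_nonneg _, ?_⟩
    -- `S v = R u` with `R` isometric into `H₊`, whose norm dominates that of `H`.
    have h2 : ‖S (v t)‖ ≤ ‖u t‖ := by
      rw [h1, hemb]
      exact (HPlus.norm_incl_le A _).trans (R.norm_map _).le
    calc C * Real.exp (2 * z.im * c) ≤ C * Real.exp (2 * z.im * t) := by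
          have := hz t ht
          have := hC0 t ht
          gcongr C * Real.exp ?_
          linarith
      _ = ‖S (v t)‖ ^ 2 := (hsq t ht).symm
      _ ≤ ‖u t‖ ^ 2 := by gcongr
  intro t ht
  have h3 : C = 0 := by
    have := Real.exp_pos (2 * z.im * c)
    have h := (Real.sqrt_eq_zero (mul_nonneg (hC0 t ht) this.le)).mp hm
    exact (mul_eq_zero.mp h).resolve_right this.ne'
  have h := hsq t ht
  rw [h3, zero_mul] at h
  exact hS (by rw [Pi.zero_apply, map_zero]; simpa using h)

theorem IsACRep.ae_eq_zero [CompleteSpace H] (hA : IsSelfAdjoint A) (hJ : IsOpen J)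
    (hv : IsACRep A J u v) (h0 : EqOn v 0 J) : u =ᵐ[volume.restrict J] 0 := by
  filter_upwards [hv.ae_eq, ae_restrict_mem hJ.measurableSet] with t h1 ht
  refine embMinus_injective hA.dense_domain ?_
  rw [← h1, h0 ht, Pi.zero_apply, Pi.zero_apply, map_zero]

theorem eq_zero_of_tendsto_embMinus [CompleteSpace H] (hA : IsSelfAdjoint A) {c : ℝ} {h : H}
    (hc : c ∈ closure J) (hlim : Tendsto v (𝓝[J] c) (𝓝 (embMinus A h))) (h0 : EqOn v 0 J) :
    h = 0 := by
  have : (𝓝[J] c).NeBot := mem_closure_iff_nhdsWithin_neBot.mp hc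
  refine embMinus_injective hA.dense_domain ?_
  rw [map_zero]
  refine tendsto_nhds_unique hlim (tendsto_const_nhds.congr' ?_)
  filter_upwards [self_mem_nhdsWithin] with t ht using (h0 ht).symm

end HalfLine

/-! ### Eigenvectors of `L_W` -/

theorem mem_graph_of_extensionOp_apply_eq {A : H →ₗ.[ℂ] H} {a b : ℝ} {W : H ≃ₗᵢ[ℂ] H} {z : ℂ}
    (u : (extensionOp A a b W).domain) (h : extensionOp A a b W u = z • (u : L2Sum H a b)) :
    ((u : L2Sum H a b).fst, z • (u : L2Sum H a b).fst) ∈ (maxOp A (Iio a)).graph ∧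
      ((u : L2Sum H a b).snd, z • (u : L2Sum H a b).snd) ∈ (maxOp A (Ioi b)).graph := by
  obtain ⟨u, hbc, h1, h2⟩ := u
  exact ⟨(LinearPMap.mem_graph_iff _).mpr ⟨⟨_, h1⟩, rfl, congrArg WithLp.fst h⟩,
    (LinearPMap.mem_graph_iff _).mpr ⟨⟨_, h2⟩, rfl, congrArg WithLp.snd h⟩⟩

end SingularDiffOp

open SingularDiffOp in
theorem theorem3p1 {H : Type*} [NormedAddCommGroup H] [InnerProductSpace ℂ H] [CompleteSpace H]
    [TopologicalSpace.SeparableSpace H] (A : H →ₗ.[ℂ] H) (hA : IsSelfAdjoint A)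
    (a b : ℝ) (hab : a < b) (W : H ≃ₗᵢ[ℂ] H) :
    SingularDiffOp.pointSpectrum (SingularDiffOp.extensionOp A a b W) = ∅ := by
  refine eq_empty_of_forall_notMem ?_
  rintro z ⟨u, hu0, hu⟩
  have hg := mem_graph_of_extensionOp_apply_eq u hu
  obtain ⟨h, ⟨v₁, hv₁, hl₁⟩, ⟨v₂, hv₂, hl₂⟩⟩ := u.2.1
  set u₁ := (u : L2Sum H a b).fst
  set u₂ := (u : L2Sum H a b).snd
  have hs₁ : SolvesOn A (Iio a) u₁ fun t => z • u₁ t :=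
    ((mem_graph_maxOp_iff hA.dense_domain isOpen_Iio _ _).mp hg.1).congr EventuallyEq.rfl
      (Lp.coeFn_smul z u₁).symm
  have hs₂ : SolvesOn A (Ioi b) u₂ fun t => z • u₂ t :=
    ((mem_graph_maxOp_iff hA.dense_domain isOpen_Ioi _ _).mp hg.2).congr EventuallyEq.rfl
      (Lp.coeFn_smul z u₂).symm
  have hca : a ∈ closure (Iio a) := by simp
  have hcb : b ∈ closure (Ioi b) := by simp
  have hv : EqOn v₁ 0 (Iio a) ∧ EqOn v₂ 0 (Ioi b) := by
    -- The sign selects the half-line on which `exp (2 Im z t)` does not decay towards infinity.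
    rcases le_total z.im 0 with hz | hz
    · have h1 : EqOn v₁ 0 (Iio a) :=
        eqOn_zero_of_solvesOn_of_memLp hA isOpen_Iio ordConnected_Iio Real.volume_Iio
          (fun t ht => mul_le_mul_of_nonpos_left (le_of_lt ht) hz) (Lp.memLp u₁) hv₁ hs₁
      have h2 := eq_zero_of_tendsto_embMinus hA hca hl₁ h1
      rw [h2, map_zero, map_zero] at hl₂
      exact ⟨h1, eqOn_zero_of_solvesOn_of_tendsto hA isOpen_Ioi ordConnected_Ioi hcb hv₂ hs₂ hl₂⟩
    · have h1 : EqOn v₂ 0 (Ioi b) :=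
        eqOn_zero_of_solvesOn_of_memLp hA isOpen_Ioi ordConnected_Ioi Real.volume_Ioi
          (fun t ht => mul_le_mul_of_nonneg_left (le_of_lt ht) hz) (Lp.memLp u₂) hv₂ hs₂
      have h2 := eq_zero_of_tendsto_embMinus hA hcb hl₂ h1
      rw [(map_eq_zero_iff W W.injective).mp h2, map_zero] at hl₁
      exact ⟨eqOn_zero_of_solvesOn_of_tendsto hA isOpen_Iio ordConnected_Iio hca hv₁ hs₁ hl₁, h1⟩
  have h1 : u₁ = 0 := Lp.eq_zero_iff_ae_eq_zero.mpr (hv₁.ae_eq_zero hA isOpen_Iio hv.1)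
  have h2 : u₂ = 0 := Lp.eq_zero_iff_ae_eq_zero.mpr (hv₂.ae_eq_zero hA isOpen_Ioi hv.2)
  exact hu0 (WithLp.ofLp_injective 2 (Prod.ext h1 h2))
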